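/- Let $\mathbb K$ be a field of characteristic zero and let $q$ be transcendental over $\mathbb K$. Let $\sigma$ be the automorphism of $\mathbb K(q)[x]$ over $\mathbb K(q)$, and of its fraction field $\mathbb K(q,x)$, with $\sigma(x)=qx$. Let $\mathbb K(q)[x][\partial]\subset \mathbb K(q,x)[\partial]$ be the rings of operators $\sum_i a_i\partial^i$ with coefficients in $\mathbb K(q)[x]$ (the $q$-Weyl algebra) and in $\mathbb K(q,x)$ respectively, with $\partial f=\sigma(f)\,\partial$. For a nonzero operator $T$, its order is its degree in $\partial$, and $\operatorname{lc}(T)$ denotes the coefficient of its highest power of $\partial$. For $P\in\mathbb K(q)[x][\partial]$ put $\operatorname{Cont}(P)=\mathbb K(q,x)[\partial]\,P\cap \mathbb K(q)[x][\partial]$. A divisor $p$ of $\operatorname{lc}(P)$ in $\mathbb K(q)[x]$ is removable from $P$ if for some $k\in\mathbb N$ there are $Q\in \mathbb K(q,x)[\partial]$ of order $k$ and $w,v\in\mathbb K(q)[x]$, $v\ne 0$, $\gcd(p,w)=1$, such that $QP\in\mathbb K(q)[x][\partial]$ and $\sigma^{-k}(\operatorname{lc}(QP))=\frac{w}{vp}\operatorname{lc}(P)$.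 Any other polynomial $p$ is called non-removable from $P$. Let $P$ have order $r>0$ and let $\operatorname{lc}(P)=p_1^{e_1}\cdots p_m^{e_m}$ up to a nonzero constant factor, where the $p_i\in\mathbb K(q)[x]$ are irreducible and pairwise coprime and all $e_i\geq 1$. A nonzero operator $L\in\operatorname{Cont}(P)$ of order $k$ is a desingularized operator for $P$ if $$\sigma^{r-k}(\operatorname{lc}(L))=\frac{a}{b\,p_1^{k_1}\cdots p_m^{k_m}}\operatorname{lc}(P)$$ for some $a,b\in\mathbb K(q)$, $b\neq0$, and $k_1,\dots,k_m\in\mathbb N$ such that $p_i^{d}$ is non-removable from $P$ for every $i$ and every $d>k_i$. For $f,g\in\mathbb K(q)[x]$ with $f(0)\ne0$ and $g\neq 0$, let $$\operatorname{dis}(f,g)=\max\bigl(\{\alpha\in\mathbb N \mid \deg_x\gcd(f(q^\alpha x),g(x))>0\}\cup\{0\}\bigr).$$ **Theorem.** Let $P=\ell_r\partial^r+\cdots+\ell_0\in\mathbb K(q)[x][\partial]$ have order $r>0$, leading coefficient $\ell_r\ne0$ and trailing coefficient $\ell_0\neq 0$. Write $\ell_r=x^e\tilde\ell_r$ with $e\in\mathbb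 N$ and $\tilde\ell_r(0)\ne0$. Then there exists a desingularized operator for $P$ of order $r+\operatorname{dis}(\tilde\ell_r,\ell_0)$. -/

import Mathlib

open Polynomial

noncomputable section

/-! ### Skew polynomial rings `R[∂; σ]` with `∂ a = σ a ∂` -/

/-- The action of the powers of `∂` on the coefficient ring: `∂ⁿ` acts as `σⁿ`. -/
abbrev skewAction {R : Type*} [CommRing R] (σ : R ≃+* R) :
    MulSemiringAction (Multiplicative ℕ) R :=
  MulSemiringAction.compHom R (powersHom (R ≃+* R) σ)

/-- The ring `R[∂; σ]` of operators `∑ aᵢ ∂ⁱ` with `aᵢ ∈ R`, where `∂ a = σ a ∂`. -/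
def SkewOp {R : Type*} [CommRing R] (_σ : R ≃+* R) : Type _ := SkewPolynomial R

namespace SkewOp

variable {R : Type*} [CommRing R] {σ : R ≃+* R}

instance : Ring (SkewOp σ) :=
  letI := skewAction σ
  inferInstanceAs (Ring (SkewPolynomial R))

/-- The coefficient of `∂ⁿ`. -/
def coeff (P : SkewOp σ) (n : ℕ) : R := SkewPolynomial.coeff (R := R) P n

/-- The operator `a ∂ⁿ`. -/
def monomial (n : ℕ) (a : R) : SkewOp σ := SkewPolynomial.monomial (R := R) n a

/-- The order (degree in `∂`) of a nonzero operator; the value at `0` is irrelevant. -/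
def order (P : SkewOp σ) : ℕ := (SkewPolynomial.support (R := R) P).sup id

/-- The leading coefficient (with respect to `∂`). -/
def lc (P : SkewOp σ) : R := P.coeff P.order

theorem monomial_mul_monomial (n m : ℕ) (a b : R) :
    (monomial n a * monomial m b : SkewOp σ) = monomial (n + m) (a * (σ ^ n) b) := by
  let := skewAction σ
  exact SkewMonoidAlgebra.single_mul_single

theorem coeff_add (P Q : SkewOp σ) (n : ℕ) : (P + Q).coeff n = P.coeff n + Q.coeff n :=
  DFunLike.congr_fun (SkewMonoidAlgebra.coeff_add (k := R) (G := Multiplicative ℕ) P Q) _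

theorem coeff_monomial (m n : ℕ) (a : R) :
    (monomial m a : SkewOp σ).coeff n = if m = n then a else 0 :=
  SkewPolynomial.coeff_monomial

/-- The coefficientwise map `R[∂; σ] → S[∂; τ]` induced by a ring homomorphism `φ : R → S`
with `φ ∘ σ = τ ∘ φ`. -/
def map {S : Type*} [CommRing S] {τ : S ≃+* S} (φ : R →+* S)
    (h : ∀ a, φ (σ a) = τ (φ a)) : SkewOp σ →+* SkewOp τ :=
  letI := skewAction σ
  letI := skewAction τ
  show SkewPolynomial R →+* SkewPolynomial S from
  SkewMonoidAlgebra.liftNCRingHom (SkewPolynomial.CRingHom.comp φ)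
    (SkewMonoidAlgebra.of S (Multiplicative ℕ)) (by
      have hpow : ∀ (n : ℕ) (a : R), φ ((σ ^ n) a) = (τ ^ n) (φ a) := by
        intro n
        induction n with
        | zero => intro a; rfl
        | succ n ih => intro a; rw [pow_succ, pow_succ, RingAut.mul_apply, RingAut.mul_apply, ih, h]
      intro x y
      have e1 : y • x = (σ ^ (Multiplicative.toAdd y)) x := rfl
      have e2 : ∀ s : S, y • s = (τ ^ (Multiplicative.toAdd y)) s := fun _ => rfl
      rw [SkewMonoidAlgebra.of_apply]
      change SkewMonoidAlgebra.single 1 (φ (y • x)) * SkewMonoidAlgebra.single y 1 =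
        SkewMonoidAlgebra.single y 1 * SkewMonoidAlgebra.single 1 (φ x)
      rw [SkewMonoidAlgebra.single_mul_single, SkewMonoidAlgebra.single_mul_single,
        e1, hpow, e2]
      simp)

theorem map_monomial {S : Type*} [CommRing S] {τ : S ≃+* S} (φ : R →+* S)
    (h : ∀ a, φ (σ a) = τ (φ a)) (m : ℕ) (a : R) :
    map φ h (monomial m a) = monomial m (φ a) := by
  let := skewAction σ
  let := skewAction τ
  refine (SkewMonoidAlgebra.liftNC_single _ _ _ _).trans ?_
  refine (monomial_mul_monomial (σ := τ) 0 m (φ a) 1).trans ?_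
  rw [map_one, mul_one, zero_add]

theorem coeff_map {S : Type*} [CommRing S] {τ : S ≃+* S} (φ : R →+* S)
    (h : ∀ a, φ (σ a) = τ (φ a)) (P : SkewOp σ) (n : ℕ) :
    (map φ h P).coeff n = φ (P.coeff n) := by
  refine SkewPolynomial.induction (R := R)
    (motive := fun P => (map φ h P).coeff n = φ (SkewOp.coeff (σ := σ) P n)) P ?_ ?_
  · have h0 : map φ h (0 : SkewOp σ) = 0 := map_zero _
    exact (congrArg (fun T => SkewOp.coeff T n) h0).trans (map_zero φ).symm
  · intro m r (Q : SkewOp σ) _ _ hQ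
    have key : (map φ h (monomial m r + Q)).coeff n = φ ((monomial m r + Q).coeff n) := by
      rw [map_add, map_monomial, coeff_add, coeff_add, hQ, coeff_monomial, coeff_monomial, map_add]
      split_ifs <;> simp
    exact key

end SkewOp

/-! ### The `q`-Weyl algebra and the `q`-rational algebra over a field `F` (here `F = K(q)`) -/

section QWeyl

variable {F : Type*} [Field F]

/-- The automorphism `σ` of `F[x]` over `F` with `σ x = q x`, i.e. `f(x) ↦ f(q x)`. -/
def qShift (q : Fˣ) : F[X] ≃ₐ[F] F[X] :=
  AlgEquiv.ofAlgHom (aeval (C (q : F) * X)) (aeval (C ((q⁻¹ : Fˣ) : F) * X))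
    (by
      ext
      simp only [AlgHom.coe_comp, Function.comp_apply, aeval_X, map_mul, aeval_C, AlgHom.id_apply,
        algebraMap_eq]
      rw [← mul_assoc, ← C_mul, ← Units.val_mul]
      simp)
    (by
      ext
      simp only [AlgHom.coe_comp, Function.comp_apply, aeval_X, map_mul, aeval_C, AlgHom.id_apply,
        algebraMap_eq]
      rw [← mul_assoc, ← C_mul, ← Units.val_mul]
      simp)

/-- The extension of `σ` to the field `F(x)` of rational functions. -/
def qShiftRat (q : Fˣ) : RatFunc F ≃+* RatFunc F :=
  IsFractionRing.ringEquivOfRingEquiv (qShift q).toRingEquiv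

/-- The `q`-Weyl algebra `F[x][∂]`, with `∂ f(x) = f(q x) ∂`. -/
abbrev QWeyl (q : Fˣ) := SkewOp (qShift q).toRingEquiv

/-- The `q`-rational algebra `F(x)[∂]`, with `∂ f(x) = f(q x) ∂`. -/
abbrev QRational (q : Fˣ) := SkewOp (qShiftRat q)

/-- The inclusion of the `q`-Weyl algebra into the `q`-rational algebra. -/
def QWeyl.toRational (q : Fˣ) : QWeyl q →+* QRational q :=
  SkewOp.map (algebraMap F[X] (RatFunc F))
    (fun a => (IsFractionRing.ringEquivOfRingEquiv_algebraMap _ a).symm)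

/-- The contraction ideal (`q`-Weyl closure) `F(x)[∂] P ∩ F[x][∂]`, a left ideal. -/
def QWeyl.cont {q : Fˣ} (P : QWeyl q) : Ideal (QWeyl q) :=
  (Ideal.span {QWeyl.toRational q P}).comap (QWeyl.toRational q)

open Classical in
/-- The `q`-dispersion: the maximum of
`{α ∈ ℕ | deg gcd (f(q^α x), g(x)) > 0} ∪ {0}` (a finite set if `f(0) ≠ 0` and `g ≠ 0`,
`q` not being a root of unity). -/
def qDispersion (q : Fˣ) (f g : F[X]) : ℕ :=
  sSup ({α : ℕ | 0 < (EuclideanDomain.gcd ((qShift q ^ α) f) g).natDegree} ∪ {0})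

/-- A divisor `p` of `lc P` is removable from `P` at order `k` if there are an operator `Q` of
order `k` over `F(x)` and `w, v ∈ F[x]`, `gcd (p, w) = 1`, such that `T = Q P` has polynomial
coefficients and `σ^(-k) (lc T) = w / (v p) * lc P`. -/
def QWeyl.RemovableAt {q : Fˣ} (P : QWeyl q) (p : F[X]) (k : ℕ) : Prop :=
  p ∣ P.lc ∧
  ∃ (Q : QRational q) (T : QWeyl q) (w v : F[X]),
    Q ≠ 0 ∧ Q.order = k ∧ v ≠ 0 ∧ IsCoprime p w ∧
    QWeyl.toRational q T = Q * QWeyl.toRational q P ∧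
    algebraMap F[X] (RatFunc F) ((qShift q ^ (-(k : ℤ))) T.lc) =
      algebraMap F[X] (RatFunc F) w /
        (algebraMap F[X] (RatFunc F) v * algebraMap F[X] (RatFunc F) p) *
        algebraMap F[X] (RatFunc F) P.lc

/-- `p` is removable from `P` if it is so at some order. -/
def QWeyl.Removable {q : Fˣ} (P : QWeyl q) (p : F[X]) : Prop :=
  ∃ k : ℕ, P.RemovableAt p k

/-- `L` is a desingularized operator for `P`: it is a nonzero element of the contraction ideal
and, for the factorization `p₁^e₁ ⋯ pₘ^eₘ` of `lc P` (up to a unit) into powers of pairwise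
coprime irreducible polynomials,
`σ^(ord P - ord L) (lc L) = a / (b p₁^k₁ ⋯ pₘ^kₘ) * lc P` with constants `a`, `b ≠ 0`, where no
power of `pᵢ` with exponent greater than `kᵢ` is removable from `P`. -/
def QWeyl.IsDesingularized {q : Fˣ} (P L : QWeyl q) : Prop :=
  L ≠ 0 ∧ L ∈ P.cont ∧
  ∃ (m : ℕ) (p : Fin m → F[X]) (e k : Fin m → ℕ) (a b : F),
    (∀ i, Irreducible (p i)) ∧ (∀ i j, i ≠ j → IsCoprime (p i) (p j)) ∧ (∀ i, 0 < e i) ∧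
    Associated P.lc (∏ i, p i ^ e i) ∧
    b ≠ 0 ∧
    algebraMap F[X] (RatFunc F) ((qShift q ^ ((P.order : ℤ) - (L.order : ℤ))) L.lc) =
      algebraMap F[X] (RatFunc F) (C a) /
        (algebraMap F[X] (RatFunc F) (C b) * ∏ i, algebraMap F[X] (RatFunc F) (p i) ^ k i) *
        algebraMap F[X] (RatFunc F) P.lc ∧
    ∀ i, ∀ d, k i < d → ¬ P.Removable (p i ^ d)

end QWeyl

end

/-! Let `D` be the dispersion and `I` the ideal of backward-shifted coefficients of `∂^(r+D)` in
members of `Cont(P)` of order at most `r+D` (`shiftedLeadIdeal`). It is principal, `I = (g)`, and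
contains `lc P = g h`. An `L` realizing `g` has shifted leading coefficient `lc P / h`, so it
suffices that every removable prime power `p^d` divides `h`. For this, `p^d` must already be
removed, up to a factor prime to `p`, by an element of `I`: this is
`Removable.exists_mem_shiftedLeadIdeal`.

Clear denominators in a removing operator to get `s T = B P`. If `p` is not associated to `x`, drop
the low terms of `B` divisible by the relevant power of `π = σ^k p` and divide by `∂^j`
(`exists_order_reduction`). The first surviving term forces `π ∣ σ^j ℓ₀`, so `σ^(k-j) p` divides
both `ℓ₀` and `σ^(k-j) f`, whence `k - j ≤ D`. If `p` is associated to `x`, it is `σ`-invariant up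
to units, and Gauss' lemma (`pow_dvd_coeff_of_pow_dvd_coeff_mul`) shows that `p^d` divides all of
`P`. -/

noncomputable section

/-! ### Coefficients, products and left division in `R[∂; σ]` -/

namespace SkewOp

variable {R : Type*} [CommRing R] {σ : R ≃+* R}

theorem ext {P Q : SkewOp σ} (h : ∀ n, P.coeff n = Q.coeff n) : P = Q :=
  SkewPolynomial.ext h

/-- The coefficient of `∂ⁿ` as an additive homomorphism. -/
def coeffHom (σ : R ≃+* R) (n : ℕ) : SkewOp σ →+ R where
  toFun P := P.coeff n
  map_zero' := rfl
  map_add' P Q := coeff_add P Q n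

@[simp]
theorem coeff_zero (n : ℕ) : (0 : SkewOp σ).coeff n = 0 := rfl

theorem coeff_sub (P Q : SkewOp σ) (n : ℕ) : (P - Q).coeff n = P.coeff n - Q.coeff n :=
  map_sub (coeffHom σ n) P Q

theorem coeff_sum {ι : Type*} (s : Finset ι) (P : ι → SkewOp σ) (n : ℕ) :
    (∑ i ∈ s, P i).coeff n = ∑ i ∈ s, (P i).coeff n :=
  map_sum (coeffHom σ n) P s

theorem coeff_eq_zero_of_order_lt {P : SkewOp σ} {n : ℕ} (h : P.order < n) : P.coeff n = 0 := by
  by_contra hn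
  have hmem : n ∈ SkewPolynomial.support (R := R) P := SkewPolynomial.mem_support_iff.2 hn
  have : n ≤ P.order := Finset.le_sup (f := id) hmem
  omega

theorem order_eq {P : SkewOp σ} {n : ℕ} (hn : P.coeff n ≠ 0) (h : ∀ m, n < m → P.coeff m = 0) :
    P.order = n := by
  apply le_antisymm
  · refine Finset.sup_le fun m hm => ?_
    by_contra hlt
    exact (SkewPolynomial.mem_support_iff.1 hm) (h m (not_le.1 hlt))
  · by_contra hlt
    exact hn (coeff_eq_zero_of_order_lt (not_le.1 hlt))

theorem lc_ne_zero {P : SkewOp σ} (h : P ≠ 0) : P.lc ≠ 0 := by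
  have hne : (SkewPolynomial.support (R := R) P).Nonempty := by
    rw [Finset.nonempty_iff_ne_empty]
    exact fun h' => h (SkewPolynomial.support_eq_empty.1 h')
  obtain ⟨n, hn, hn'⟩ := Finset.exists_mem_eq_sup _ hne id
  have : P.order = n := hn'
  rw [lc, this]
  exact SkewPolynomial.mem_support_iff.1 hn

/-- The operator `∑_{i < N} cᵢ ∂ⁱ`. -/
def ofCoeffs (σ : R ≃+* R) (N : ℕ) (c : ℕ → R) : SkewOp σ :=
  ∑ i ∈ Finset.range N, monomial i (c i)

theorem coeff_ofCoeffs (N : ℕ) (c : ℕ → R) (n : ℕ) :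
    (ofCoeffs σ N c).coeff n = if n < N then c n else 0 := by
  simp [ofCoeffs, coeff_sum, coeff_monomial]

theorem eq_ofCoeffs (P : SkewOp σ) {N : ℕ} (h : ∀ n, N ≤ n → P.coeff n = 0) :
    P = ofCoeffs σ N P.coeff := by
  apply ext
  intro n
  rw [coeff_ofCoeffs]
  split_ifs with hn
  · rfl
  · exact h n (not_lt.1 hn)

theorem coeff_mul (A B : SkewOp σ) (n : ℕ) :
    (A * B).coeff n = ∑ x ∈ Finset.HasAntidiagonal.antidiagonal n, A.coeff x.1 * (σ ^ x.1) (B.coeff x.2) := by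
  obtain ⟨N, hA, hB⟩ : ∃ N, (∀ n, N ≤ n → A.coeff n = 0) ∧ ∀ n, N ≤ n → B.coeff n = 0 :=
    ⟨max A.order B.order + 1, fun n hn => coeff_eq_zero_of_order_lt (by omega),
      fun n hn => coeff_eq_zero_of_order_lt (by omega)⟩
  conv_lhs => rw [eq_ofCoeffs A hA, eq_ofCoeffs B hB, ofCoeffs, ofCoeffs, Finset.sum_mul_sum,
    ← Finset.sum_product']
  simp only [coeff_sum, monomial_mul_monomial, coeff_monomial]
  rw [← Finset.sum_filter]
  refine Finset.sum_subset (fun x hx => ?_) fun x _ hx => ?_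
  · exact Finset.HasAntidiagonal.mem_antidiagonal.2 (Finset.mem_filter.1 hx).2
  · rename_i hxn
    rw [Finset.HasAntidiagonal.mem_antidiagonal] at hxn
    simp only [Finset.mem_filter, Finset.mem_product, Finset.mem_range, hxn, and_true,
      not_and_or, not_lt] at hx
    rcases hx with hx | hx
    · rw [hA _ hx, zero_mul]
    · rw [hB _ hx, map_zero, mul_zero]

theorem coeff_monomial_zero_mul (s : R) (A : SkewOp σ) (n : ℕ) :
    (monomial 0 s * A).coeff n = s * A.coeff n := by
  rw [coeff_mul, Finset.sum_eq_single (0, n)]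
  · simp [coeff_monomial]
  · rintro ⟨i, j⟩ hij hne
    have : 0 ≠ i := by
      rintro rfl
      simp at hij
      exact hne (by simp [hij])
    simp [coeff_monomial, this]
  · simp

theorem coeff_monomial_mul (j : ℕ) (a : R) (A : SkewOp σ) (n : ℕ) :
    (monomial j a * A).coeff (j + n) = a * (σ ^ j) (A.coeff n) := by
  rw [coeff_mul, Finset.sum_eq_single (j, n)]
  · simp [coeff_monomial]
  · rintro ⟨i, m⟩ hij hne
    have : j ≠ i := by
      rintro rfl
      simp at hij
      exact hne (by simp [hij])
    simp [coeff_monomial, this]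
  · simp

theorem coeff_monomial_mul_of_lt {j n : ℕ} (h : n < j) (a : R) (A : SkewOp σ) :
    (monomial j a * A).coeff n = 0 := by
  rw [coeff_mul]
  refine Finset.sum_eq_zero fun x hx => ?_
  have : j ≠ x.1 := by
    have := Finset.HasAntidiagonal.mem_antidiagonal.1 hx
    omega
  simp [coeff_monomial, this]

theorem coeff_mul_top {A B : SkewOp σ} {k r : ℕ} (hA : ∀ n, k < n → A.coeff n = 0)
    (hB : ∀ n, r < n → B.coeff n = 0) :
    (A * B).coeff (k + r) = A.coeff k * (σ ^ k) (B.coeff r) := by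
  rw [coeff_mul, Finset.sum_eq_single (k, r)]
  · rintro ⟨i, m⟩ hij hne
    have h := Finset.HasAntidiagonal.mem_antidiagonal.1 hij
    rcases lt_or_ge k i with hi | hi
    · simp [hA i hi]
    · rcases lt_or_ge r m with hm | hm
      · simp [hB m hm]
      · exact absurd (by simp at h ⊢; omega) hne
  · simp

theorem coeff_mul_eq_zero {A B : SkewOp σ} {k r : ℕ} (hA : ∀ n, k < n → A.coeff n = 0)
    (hB : ∀ n, r < n → B.coeff n = 0) {n : ℕ} (hn : k + r < n) :
    (A * B).coeff n = 0 := by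
  rw [coeff_mul]
  refine Finset.sum_eq_zero fun x hx => ?_
  have h := Finset.HasAntidiagonal.mem_antidiagonal.1 hx
  rcases lt_or_ge k x.1 with hi | hi
  · simp [hA _ hi]
  · simp [hB x.2 (by omega)]

/-- Left division by `∂ʲ`: an operator all of whose terms have order at least `j`. -/
theorem exists_eq_monomial_mul (A : SkewOp σ) {j : ℕ} (h : ∀ n, n < j → A.coeff n = 0) :
    ∃ B : SkewOp σ, A = monomial j 1 * B := by
  -- Since `∂ʲ b = σʲ(b) ∂ʲ`, the coefficients are pulled back through `σʲ`.
  refine ⟨ofCoeffs σ (A.order + 1) fun n => (σ ^ j).symm (A.coeff (j + n)), ext fun n => ?_⟩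
  rcases lt_or_ge n j with hn | hn
  · rw [h n hn, coeff_monomial_mul_of_lt hn]
  · obtain ⟨m, rfl⟩ := Nat.exists_eq_add_of_le hn
    rw [coeff_monomial_mul, coeff_ofCoeffs]
    split_ifs with hm
    · simp
    · simp [coeff_eq_zero_of_order_lt (P := A) (n := j + m) (by omega)]

theorem monomial_one_mul_left_injective (j : ℕ) {A B : SkewOp σ}
    (h : monomial j 1 * A = monomial j 1 * B) : A = B := by
  refine ext fun n => ?_
  have := congrArg (fun T => T.coeff (j + n)) h
  rwa [coeff_monomial_mul, coeff_monomial_mul, one_mul, one_mul, EquivLike.apply_eq_iff_eq] at this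

theorem exists_eq_monomial_zero_mul {s : R} {A : SkewOp σ} (h : ∀ n, s ∣ A.coeff n) :
    ∃ B : SkewOp σ, A = monomial 0 s * B := by
  choose c hc using h
  refine ⟨ofCoeffs σ (A.order + 1) c, ext fun n => ?_⟩
  rw [coeff_monomial_zero_mul, coeff_ofCoeffs]
  split_ifs with hn
  · exact hc n
  · rw [mul_zero, coeff_eq_zero_of_order_lt (by omega)]

theorem monomial_mul_monomial_zero (j : ℕ) (s : R) :
    (monomial j 1 * monomial 0 s : SkewOp σ) = monomial 0 ((σ ^ j) s) * monomial j 1 := by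
  simp [monomial_mul_monomial]

/-! ### Gauss' lemma and order reduction -/

/-- Gauss' lemma for a prime that is `σ`-invariant up to units. -/
theorem pow_dvd_coeff_of_pow_dvd_coeff_mul [IsDomain R] {p : R} (hp : Prime p)
    (hσ : ∀ (i n : ℕ) (a : R), p ^ n ∣ (σ ^ i) a ↔ p ^ n ∣ a) {A B : SkewOp σ} {a b : ℕ}
    (h : ∀ n, p ^ (a + b + 1) ∣ (A * B).coeff n) :
    (∀ n, p ^ (a + 1) ∣ A.coeff n) ∨ ∀ n, p ^ (b + 1) ∣ B.coeff n := by
  classical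
  -- Here `p ^ c'` is the exact power of `p` in the content of `C`, and `i` is the first index where
  -- `p ^ (c' + 1)` fails to divide.
  have key : ∀ (C : SkewOp σ) (c : ℕ), (¬ ∀ n, p ^ (c + 1) ∣ C.coeff n) →
      ∃ c' ≤ c, ∃ i, (∀ n, p ^ c' ∣ C.coeff n) ∧ ¬ p ^ (c' + 1) ∣ C.coeff i ∧
        ∀ n < i, p ^ (c' + 1) ∣ C.coeff n := by
    intro C c hC
    have hex : ∃ m, ∃ i, ¬ p ^ (m + 1) ∣ C.coeff i := ⟨c, not_forall.1 hC⟩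
    refine ⟨Nat.find hex, Nat.find_min' hex (not_forall.1 hC), Nat.find (Nat.find_spec hex),
      ?_, Nat.find_spec (Nat.find_spec hex), fun n hn => ?_⟩
    · intro n
      rcases hm : Nat.find hex with _ | m
      · simp
      · have := Nat.find_min hex (m := m) (by omega)
        push Not at this
        exact this n
    · exact not_not.1 (Nat.find_min (Nat.find_spec hex) hn)
  by_contra! hcon
  obtain ⟨hA, hB⟩ := hcon
  obtain ⟨a', ha', i, hA1, hA2, hA3⟩ := key A a (by push Not; exact hA)
  obtain ⟨b', hb', j, hB1, hB2, hB3⟩ := key B b (by push Not; exact hB)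
  have h1 : p ^ (a' + b' + 1) ∣ (A * B).coeff (i + j) :=
    (pow_dvd_pow p (by omega)).trans (h _)
  rw [coeff_mul, ← Finset.add_sum_erase _ _ (Finset.HasAntidiagonal.mem_antidiagonal.2 (rfl : (i, j).1 + _ = i + j))]
    at h1
  -- Every other pair on the antidiagonal has its first index below `i` or its second below `j`,
  -- which supplies the extra factor `p`.
  have h2 : p ^ (a' + b' + 1) ∣ A.coeff i * (σ ^ i) (B.coeff j) := by
    refine (dvd_add_left (Finset.dvd_sum ?_)).1 h1
    rintro ⟨m, n⟩ hmn
    obtain ⟨hne, hmn⟩ := Finset.mem_erase.1 hmn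
    have hs := Finset.HasAntidiagonal.mem_antidiagonal.1 hmn
    simp only at hs ⊢
    rcases lt_trichotomy m i with hm | rfl | hm
    · rw [show a' + b' + 1 = (a' + 1) + b' by ring, pow_add]
      exact mul_dvd_mul (hA3 m hm) ((hσ _ _ _).2 (hB1 n))
    · exact absurd (by simp; omega) hne
    · rw [show a' + b' + 1 = a' + (b' + 1) by ring, pow_add]
      exact mul_dvd_mul (hA1 m) ((hσ _ _ _).2 (hB3 n (by omega)))
  rcases succ_dvd_or_succ_dvd_of_succ_sum_dvd_mul hp (hA1 i) ((hσ i b' _).2 (hB1 j)) h2 with h3 | h3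
  · exact hA2 h3
  · exact hB2 ((hσ _ _ _).1 h3)

/-- Reduction of the order of a left multiple: if `s T = B P` and the prime power `π ^ N` divides
`s` but not the coefficient of `∂ᵏ` in `B`, then the part of `B` below the first coefficient not
divisible by `π ^ N` can be dropped, and the remaining part divided by a power of `∂`. -/
theorem exists_order_reduction [IsDomain R] {π : R} (hπ : Prime π) {P T B : SkewOp σ} {s : R}
    {N k r : ℕ} (hs : π ^ N ∣ s) (h : monomial 0 s * T = B * P)
    (hB : ∀ n, k < n → B.coeff n = 0) (hk : ¬ π ^ N ∣ B.coeff k)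
    (hP : ∀ n, r < n → P.coeff n = 0) :
    ∃ j ≤ k, π ∣ (σ ^ j) (P.coeff 0) ∧ ∃ (t : R) (B' T' : SkewOp σ), t ≠ 0 ∧
      monomial 0 t * T' = B' * P ∧ (∀ n, k - j + r < n → T'.coeff n = 0) ∧
      π ^ N * (σ ^ j) (T'.coeff (k - j + r)) = B.coeff k * (σ ^ k) (P.coeff r) := by
  classical
  have hex : ∃ j, ¬ π ^ N ∣ B.coeff j := ⟨k, hk⟩
  obtain ⟨j, hj, hjmin⟩ : ∃ j, ¬ π ^ N ∣ B.coeff j ∧ ∀ i < j, π ^ N ∣ B.coeff i :=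
    ⟨Nat.find hex, Nat.find_spec hex, fun i hi => not_not.1 (Nat.find_min hex hi)⟩
  have hjk : j ≤ k := by
    by_contra hlt
    exact hj (by simp [hB j (by omega)])
  have hπ0 : π ^ N ≠ 0 := pow_ne_zero _ hπ.ne_zero
  refine ⟨j, hjk, ?_, ?_⟩
  · have h1 : π ^ N ∣ (B * P).coeff j := by
      rw [← h, coeff_monomial_zero_mul]
      exact hs.mul_right _
    rw [coeff_mul, ← Finset.add_sum_erase _ _
      (Finset.HasAntidiagonal.mem_antidiagonal.2 (rfl : (j, 0).1 + _ = j))] at h1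
    -- The remaining terms involve only coefficients of `B` below `j`, all divisible by `π ^ N`.
    have h2 : π ^ N ∣ B.coeff j * (σ ^ j) (P.coeff 0) := by
      refine (dvd_add_left (Finset.dvd_sum ?_)).1 h1
      rintro ⟨m, n⟩ hmn
      obtain ⟨hne, hmn⟩ := Finset.mem_erase.1 hmn
      have hs := Finset.HasAntidiagonal.mem_antidiagonal.1 hmn
      simp only at hs
      have : m ≠ j := by
        rintro rfl
        exact hne (by simp; omega)
      exact (hjmin m (by omega)).mul_right _
    by_contra hnd
    exact hj (hπ.pow_dvd_of_dvd_mul_right N hnd h2)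
  -- Split `B = π ^ N A + ∂ʲ B'`. With `s = π ^ N u`, this gives `∂ʲ B' P = π ^ N (u T - A P)`;
  -- cancelling `π ^ N` coefficientwise shows that the bracket is `∂ʲ T'`.
  · obtain ⟨A, hA⟩ := exists_eq_monomial_zero_mul (σ := σ) (s := π ^ N)
      (A := ofCoeffs σ j B.coeff) (fun n => by
        rw [coeff_ofCoeffs]
        split_ifs with hn
        · exact hjmin n hn
        · exact dvd_zero _)
    obtain ⟨B', hB'⟩ := exists_eq_monomial_mul (B - ofCoeffs σ j B.coeff) (j := j) (fun n hn => by
      rw [coeff_sub, coeff_ofCoeffs, if_pos hn, sub_self])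
    obtain ⟨u, rfl⟩ := hs
    have h1 : monomial j 1 * B' * P = monomial 0 (π ^ N) * (monomial 0 u * T - A * P) := by
      rw [← hB', hA, sub_mul, mul_sub, ← h, ← mul_assoc, ← mul_assoc, monomial_mul_monomial]
      simp
    obtain ⟨T', hT'⟩ := exists_eq_monomial_mul (monomial 0 u * T - A * P) (j := j) (fun n hn => by
      have := congrArg (fun T => T.coeff n) h1
      simp only [mul_assoc] at this
      rw [coeff_monomial_mul_of_lt hn, coeff_monomial_zero_mul] at this
      exact (mul_eq_zero.1 this.symm).resolve_left hπ0)
    rw [hT'] at h1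
    have hB'c : ∀ n, (σ ^ j) (B'.coeff n) = B.coeff (j + n) := by
      intro n
      have := congrArg (fun T => T.coeff (j + n)) hB'
      simp only [coeff_sub, coeff_monomial_mul, coeff_ofCoeffs] at this
      simpa using this.symm
    have hB'0 : ∀ n, k - j < n → B'.coeff n = 0 := by
      intro n hn
      have := hB'c n
      rw [hB _ (by omega)] at this
      exact (map_eq_zero_iff _ (σ ^ j).injective).1 this
    have hT'c : ∀ n, π ^ N * (σ ^ j) (T'.coeff n) = (σ ^ j) ((B' * P).coeff n) := by
      intro n
      have := congrArg (fun T => T.coeff (j + n)) h1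
      simp only [mul_assoc] at this
      rw [coeff_monomial_mul, coeff_monomial_zero_mul, coeff_monomial_mul] at this
      simpa using this.symm
    -- Moving `π ^ N` to the right of `∂ʲ` turns it into its preimage under `σʲ`, after which `∂ʲ`
    -- cancels on the left.
    refine ⟨(σ ^ j).symm (π ^ N), B', T', (map_ne_zero_iff _ (σ ^ j).symm.injective).2 hπ0, ?_, ?_, ?_⟩
    · apply monomial_one_mul_left_injective j
      rw [← mul_assoc, ← mul_assoc, monomial_mul_monomial_zero, h1, RingEquiv.apply_symm_apply,
        mul_assoc]
    · intro n hn
      have := hT'c n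
      rw [coeff_mul_eq_zero hB'0 hP hn] at this
      rw [map_zero] at this
      exact (map_eq_zero_iff _ (σ ^ j).injective).1 ((mul_eq_zero.1 this).resolve_left hπ0)
    · rw [hT'c, coeff_mul_top hB'0 hP, map_mul, hB'c, Nat.add_sub_cancel' hjk,
        ← RingAut.mul_apply, ← pow_add, Nat.add_sub_cancel' hjk]

end SkewOp

/-! ### The `q`-shift and finiteness of the dispersion -/

section QWeyl

variable {F : Type*} [Field F] {q : Fˣ}

theorem qShift_toRingEquiv_pow_apply (n : ℕ) (f : F[X]) :
    ((qShift q).toRingEquiv ^ n) f = (qShift q ^ n) f := by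
  induction n generalizing f with
  | zero => rfl
  | succ n ih =>
    rw [pow_succ, pow_succ, RingAut.mul_apply, AlgEquiv.mul_apply, ih]
    rfl

theorem qShift_pow_apply (n : ℕ) (f : F[X]) :
    (qShift q ^ n) f = f.comp (C ((q : F) ^ n) * X) := by
  induction n generalizing f with
  | zero => simp
  | succ n ih =>
    have h1 : qShift q f = f.comp (C (q : F) * X) := rfl
    rw [pow_succ, AlgEquiv.mul_apply, ih, h1, comp_assoc]
    congr 1
    simp only [mul_comp, C_comp, X_comp, pow_succ, C_mul]
    ring

theorem qShift_zpow_neg_apply_eq_iff (n : ℕ) (f g : F[X]) :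
    (qShift q ^ (-(n : ℤ))) f = g ↔ f = (qShift q ^ n) g := by
  rw [zpow_neg, zpow_natCast]
  constructor
  · rintro rfl
    rw [← AlgEquiv.mul_apply, mul_inv_cancel, AlgEquiv.one_apply]
  · rintro rfl
    rw [← AlgEquiv.mul_apply, inv_mul_cancel, AlgEquiv.one_apply]

theorem prime_qShift_pow {p : F[X]} (hp : Prime p) (n : ℕ) : Prime ((qShift q ^ n) p) :=
  (MulEquiv.prime_iff (qShift q ^ n)).2 hp

/-- For nonzero polynomials `f`, `g` with `f(0) ≠ 0`, only finitely many `f(q^α x)` have a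
nontrivial common divisor with `g`. -/
theorem finite_setOf_gcd_qShift_pow [DecidableEq F] (hq : ∀ n : ℕ, 0 < n → (q : F) ^ n ≠ 1)
    {f g : F[X]} (hf : f.eval 0 ≠ 0) (hg : g ≠ 0) :
    {α : ℕ | 0 < (EuclideanDomain.gcd ((qShift q ^ α) f) g).natDegree}.Finite := by
  have hinj : Function.Injective fun n : ℕ => algebraMap F (AlgebraicClosure F) ((q : F) ^ n) := by
    intro m n hmn
    replace hmn := (algebraMap F (AlgebraicClosure F)).injective hmn
    by_contra hne
    wlog hlt : m < n generalizing m n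
    · exact this hmn.symm (Ne.symm hne) (by omega)
    obtain ⟨d, rfl⟩ := Nat.exists_eq_add_of_le hlt.le
    rw [pow_add] at hmn
    exact hq d (by omega) (mul_left_cancel₀ (pow_ne_zero m q.ne_zero) (by rw [← hmn, mul_one]))
  -- A common root `z` makes `q^α z` a root of `f` and `z` a root of `g`, so `q^α` is one of
  -- finitely many quotients of roots; `z ≠ 0` because `f(0) ≠ 0`.
  refine Set.Finite.subset (((Set.Finite.prod (f.rootSet_finite (AlgebraicClosure F))
    (g.rootSet_finite (AlgebraicClosure F))).image fun x => x.1 / x.2).preimage hinj.injOn) ?_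
  intro α hα
  have hf0 : f ≠ 0 := by
    rintro rfl
    simp at hf
  obtain ⟨z, hz⟩ := IsAlgClosed.exists_aeval_eq_zero (AlgebraicClosure F) _
    (fun h => (natDegree_pos_iff_degree_pos.1 hα).ne' h)
  have hzf : aeval z ((qShift q ^ α) f) = 0 :=
    aeval_eq_zero_of_dvd_aeval_eq_zero (EuclideanDomain.gcd_dvd_left _ _) hz
  have hzg : aeval z g = 0 :=
    aeval_eq_zero_of_dvd_aeval_eq_zero (EuclideanDomain.gcd_dvd_right _ _) hz
  rw [qShift_pow_apply, aeval_comp] at hzf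
  have hz0 : z ≠ 0 := by
    rintro rfl
    simp only [map_mul, aeval_C, aeval_X, mul_zero] at hzf
    rw [← map_zero (algebraMap F (AlgebraicClosure F)), aeval_algebraMap_apply] at hzf
    exact hf (by simpa using hzf)
  refine ⟨(aeval z (C ((q : F) ^ α) * X), z), ⟨(mem_rootSet.2 ⟨hf0, hzf⟩),
    mem_rootSet.2 ⟨hg, hzg⟩⟩, ?_⟩
  simp [hz0]

/-- Finiteness is essential: `sSup` of an unbounded set of naturals is `0` by default. -/
theorem le_qDispersion (hq : ∀ n : ℕ, 0 < n → (q : F) ^ n ≠ 1) {f g p : F[X]}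
    (hf : f.eval 0 ≠ 0) (hg : g ≠ 0) {n : ℕ} (hp : Irreducible p) (h1 : p ∣ (qShift q ^ n) f)
    (h2 : p ∣ g) : n ≤ qDispersion q f g := by
  classical
  unfold qDispersion
  refine le_csSup ?_ (Or.inl ?_)
  · refine Set.Finite.bddAbove (Set.Finite.union ?_ (Set.finite_singleton 0))
    convert finite_setOf_gcd_qShift_pow hq hf hg
  · have hdvd := EuclideanDomain.dvd_gcd h1 h2
    have := natDegree_le_of_dvd hdvd fun h0 => hg (EuclideanDomain.gcd_eq_zero_iff.1 h0).2
    have := hp.natDegree_pos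
    simp only [Set.mem_ofPred_eq]
    convert lt_of_lt_of_le ‹0 < p.natDegree› ‹_›

/-! ### The contraction ideal and removable prime powers -/

namespace QWeyl

theorem coeff_toRational (A : QWeyl q) (n : ℕ) :
    (toRational q A).coeff n = algebraMap F[X] (RatFunc F) (A.coeff n) :=
  SkewOp.coeff_map _ _ A n

theorem toRational_monomial (n : ℕ) (a : F[X]) :
    toRational q (SkewOp.monomial n a) = SkewOp.monomial n (algebraMap F[X] (RatFunc F) a) :=
  SkewOp.map_monomial _ _ n a

theorem toRational_injective : Function.Injective (toRational q) := by
  intro A B h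
  refine SkewOp.ext fun n => ?_
  have := congrArg (fun T => T.coeff n) h
  simp only [coeff_toRational] at this
  exact IsFractionRing.injective F[X] (RatFunc F) this

theorem mem_cont {P T : QWeyl q} :
    T ∈ P.cont ↔ ∃ Q : QRational q, Q * toRational q P = toRational q T := by
  rw [cont, Ideal.mem_comap, Ideal.mem_span_singleton']

theorem mem_cont_of_monomial_zero_mul_eq {P T B : QWeyl q} {s : F[X]} (hs : s ≠ 0)
    (h : SkewOp.monomial 0 s * T = B * P) : T ∈ P.cont := by
  have hs' : algebraMap F[X] (RatFunc F) s ≠ 0 := RatFunc.algebraMap_ne_zero hs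
  refine mem_cont.2 ⟨SkewOp.monomial 0 (algebraMap F[X] (RatFunc F) s)⁻¹ * toRational q B, ?_⟩
  rw [mul_assoc, ← map_mul, ← h, map_mul, ← mul_assoc]
  refine SkewOp.ext fun n => ?_
  rw [toRational_monomial, SkewOp.monomial_mul_monomial, SkewOp.coeff_monomial_zero_mul]
  simp [hs']

/-- Clearing the denominators of an operator over `F(x)`. -/
theorem exists_toRational_eq_monomial_zero_mul (Q : QRational q) :
    ∃ (s : F[X]) (B : QWeyl q), s ≠ 0 ∧
      toRational q B = SkewOp.monomial 0 (algebraMap F[X] (RatFunc F) s) * Q := by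
  obtain ⟨s, hs⟩ := IsLocalization.exist_integer_multiples (nonZeroDivisors F[X])
    (Finset.range (Q.order + 1)) Q.coeff
  have hc : ∀ n, ∃ c : F[X], algebraMap F[X] (RatFunc F) c =
      algebraMap F[X] (RatFunc F) s * Q.coeff n := by
    intro n
    rcases lt_or_ge Q.order n with hn | hn
    · exact ⟨0, by simp [SkewOp.coeff_eq_zero_of_order_lt hn]⟩
    · obtain ⟨c, hc⟩ := hs n (by simp; omega)
      exact ⟨c, by rw [hc, Algebra.smul_def]⟩
  choose c hc using hc
  refine ⟨s, SkewOp.ofCoeffs _ (Q.order + 1) c, nonZeroDivisors.ne_zero s.2, SkewOp.ext fun n => ?_⟩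
  rw [coeff_toRational, SkewOp.coeff_monomial_zero_mul, SkewOp.coeff_ofCoeffs, ← hc]
  split_ifs with hn
  · rfl
  · rw [hc, SkewOp.coeff_eq_zero_of_order_lt (by omega)]
    simp

/-- The ideal of the `n`-fold backward shifts of the coefficients of `∂^(ord P + n)` in the
operators of order at most `ord P + n` of the contraction ideal. -/
def shiftedLeadIdeal (P : QWeyl q) (n : ℕ) : Ideal F[X] where
  carrier := {g | ∃ T ∈ P.cont, (∀ m, P.order + n < m → T.coeff m = 0) ∧
    T.coeff (P.order + n) = (qShift q ^ n) g}
  zero_mem' := ⟨0, zero_mem _, fun _ _ => rfl, by simp⟩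
  add_mem' := by
    rintro a b ⟨S, hS, hS0, hSn⟩ ⟨T, hT, hT0, hTn⟩
    refine ⟨S + T, add_mem hS hT, fun m hm => ?_, ?_⟩
    · rw [SkewOp.coeff_add, hS0 m hm, hT0 m hm, add_zero]
    · rw [SkewOp.coeff_add, hSn, hTn, map_add]
  smul_mem' := by
    rintro c a ⟨T, hT, hT0, hTn⟩
    refine ⟨SkewOp.monomial 0 ((qShift q ^ n) c) * T, Ideal.mul_mem_left _ _ hT, fun m hm => ?_, ?_⟩
    · rw [SkewOp.coeff_monomial_zero_mul, hT0 m hm, mul_zero]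
    · rw [SkewOp.coeff_monomial_zero_mul, hTn, smul_eq_mul, map_mul]

/-- Left multiplication by `∂^d` raises the order and applies `σ^d` to the top coefficient, which
the backward shift undoes. -/
theorem shiftedLeadIdeal_mono (P : QWeyl q) {m n : ℕ} (hmn : m ≤ n) :
    P.shiftedLeadIdeal m ≤ P.shiftedLeadIdeal n := by
  rintro g ⟨T, hT, hT0, hTn⟩
  obtain ⟨d, rfl⟩ := Nat.exists_eq_add_of_le hmn
  refine ⟨SkewOp.monomial d 1 * T, Ideal.mul_mem_left _ _ hT, fun i hi => ?_, ?_⟩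
  · obtain ⟨i, rfl⟩ := Nat.exists_eq_add_of_le (show d ≤ i by omega)
    rw [SkewOp.coeff_monomial_mul, hT0 i (by omega), map_zero, mul_zero]
  · rw [show P.order + (m + d) = d + (P.order + m) by ring, SkewOp.coeff_monomial_mul, hTn,
      qShift_toRingEquiv_pow_apply, one_mul, ← AlgEquiv.mul_apply, ← pow_add, add_comm d m]

theorem lc_mem_shiftedLeadIdeal (P : QWeyl q) (n : ℕ) : P.lc ∈ P.shiftedLeadIdeal n :=
  P.shiftedLeadIdeal_mono (Nat.zero_le n)
    ⟨P, mem_cont.2 ⟨1, one_mul _⟩, fun _ hm => SkewOp.coeff_eq_zero_of_order_lt hm, rfl⟩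

/-- Removability of a prime power in terms of a fraction free multiple. -/
theorem RemovableAt.exists_monomial_zero_mul_eq {P : QWeyl q} (hP : P.lc ≠ 0) {p : F[X]}
    (hp : Prime p) {d k : ℕ} (hd : 0 < d) (h : P.RemovableAt (p ^ d) k) :
    ∃ (s c : F[X]) (T B : QWeyl q) (n : ℕ), SkewOp.monomial 0 s * T = B * P ∧
      (∀ m, k < m → B.coeff m = 0) ∧ ((qShift q ^ k) p) ^ (n + d) ∣ s ∧
      B.coeff k = ((qShift q ^ k) p) ^ n * c ∧ ¬ (qShift q ^ k) p ∣ c := by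
  obtain ⟨-, Q, T, w, v, hQ, hQk, hv, hpw, hT, hlc⟩ := h
  have hπ : Prime ((qShift q ^ k) p) := prime_qShift_pow hp k
  obtain ⟨s, B, hs, hB⟩ := exists_toRational_eq_monomial_zero_mul Q
  have hTB : SkewOp.monomial 0 s * T = B * P := by
    apply toRational_injective
    rw [map_mul, map_mul, hT, hB, mul_assoc]
    rw [toRational_monomial]
  have hBc : ∀ n, algebraMap F[X] (RatFunc F) (B.coeff n) =
      algebraMap F[X] (RatFunc F) s * Q.coeff n := by
    intro n
    have := congrArg (fun T => T.coeff n) hB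
    simpa only [coeff_toRational, SkewOp.coeff_monomial_zero_mul] using this
  have hs' : algebraMap F[X] (RatFunc F) s ≠ 0 := RatFunc.algebraMap_ne_zero hs
  have hinj := IsFractionRing.injective F[X] (RatFunc F)
  have hB0 : ∀ m, k < m → B.coeff m = 0 := by
    intro m hm
    apply hinj
    rw [hBc, SkewOp.coeff_eq_zero_of_order_lt (by omega), mul_zero, map_zero]
  have hBk : B.coeff k ≠ 0 := by
    intro h0
    have := hBc k
    rw [h0, map_zero, ← hQk] at this
    exact mul_ne_zero hs' (SkewOp.lc_ne_zero hQ) this.symm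
  have hP0 : ∀ m, P.order < m → P.coeff m = 0 := fun m hm => SkewOp.coeff_eq_zero_of_order_lt hm
  have htop : s * T.coeff (k + P.order) = B.coeff k * (qShift q ^ k) P.lc := by
    rw [← SkewOp.coeff_monomial_zero_mul, hTB, SkewOp.coeff_mul_top hB0 hP0, qShift_toRingEquiv_pow_apply]
    rfl
  have hσlc : (qShift q ^ k) P.lc ≠ 0 :=
    (map_ne_zero_iff _ (qShift q ^ k).injective).2 hP
  -- The nonzero top coefficient fixes the order of `T`, linking `T.lc` in the removability
  -- condition to the product `B P`.
  have hTlc : T.lc = T.coeff (k + P.order) := by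
    rw [SkewOp.lc, SkewOp.order_eq (n := k + P.order)]
    · intro h0
      rw [h0, mul_zero] at htop
      exact mul_ne_zero hBk hσlc htop.symm
    · intro m hm
      have := SkewOp.coeff_mul_eq_zero hB0 hP0 hm
      rw [← hTB, SkewOp.coeff_monomial_zero_mul] at this
      exact (mul_eq_zero.1 this).resolve_left hs
  obtain ⟨τ, hτ⟩ : ∃ τ, (qShift q ^ (-(k : ℤ))) T.lc = τ := ⟨_, rfl⟩
  have hτ' := (qShift_zpow_neg_apply_eq_iff _ _ _).1 hτ
  have hlc' : v * p ^ d * τ = w * P.lc := by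
    apply hinj
    have hv' : algebraMap F[X] (RatFunc F) v ≠ 0 := RatFunc.algebraMap_ne_zero hv
    have hp' : algebraMap F[X] (RatFunc F) (p ^ d) ≠ 0 :=
      RatFunc.algebraMap_ne_zero (pow_ne_zero _ hp.ne_zero)
    rw [hτ] at hlc
    rw [map_mul, map_mul, map_mul, hlc]
    field_simp
  have hlc2 := congrArg (qShift q ^ k) hlc'
  simp only [map_mul, map_pow, ← hτ', hTlc] at hlc2
  -- As `σ^k p` does not divide `σ^k w`, its whole power on the left must divide `s`: at least `d`
  -- more than its multiplicity `n` in `B.coeff k`.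
  have hmain : (qShift q ^ k) v * ((qShift q ^ k) p) ^ d * B.coeff k = (qShift q ^ k) w * s := by
    apply mul_right_cancel₀ hσlc
    linear_combination s * hlc2 - (qShift q ^ k) v * ((qShift q ^ k) p) ^ d * htop
  have hpw' : ¬ p ∣ w := fun hdvd =>
    hp.not_isUnit (hpw.isUnit_of_dvd' (dvd_pow_self p hd.ne') hdvd)
  have hπw : ¬ (qShift q ^ k) p ∣ (qShift q ^ k) w := by rwa [map_dvd_iff]
  obtain ⟨c, hc, hBc⟩ :=
    (FiniteMultiplicity.of_prime_left hπ hBk).exists_eq_pow_mul_and_not_dvd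
  refine ⟨s, c, T, B, _, hTB, hB0, ?_, hc, hBc⟩
  refine hπ.pow_dvd_of_dvd_mul_left _ hπw ?_
  rw [← hmain, pow_add]
  refine ⟨(qShift q ^ k) v * c, ?_⟩
  conv_lhs => rw [hc]
  ring

/-- A removable prime power is removable at the order given by the `q`-dispersion. -/
theorem Removable.exists_mem_shiftedLeadIdeal (hq : ∀ n : ℕ, 0 < n → (q : F) ^ n ≠ 1)
    {P : QWeyl q} (h0 : P.coeff 0 ≠ 0) {e : ℕ} {f : F[X]} (hf : P.lc = X ^ e * f)
    (hf0 : f.eval 0 ≠ 0) {p : F[X]} (hp : Prime p) {d : ℕ} (hd : 0 < d)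
    (h : P.Removable (p ^ d)) :
    ∃ g ∈ P.shiftedLeadIdeal (qDispersion q f (P.coeff 0)), ∃ w, ¬ p ∣ w ∧
      p ^ d * g = w * P.lc := by
  have hP : P.lc ≠ 0 := SkewOp.lc_ne_zero (by
    rintro rfl
    exact h0 rfl)
  obtain ⟨k, hk⟩ := h
  have hpdvd : p ∣ P.lc := (dvd_pow_self p hd.ne').trans hk.1
  obtain ⟨s, c, T, B, n, hTB, hB0, hs, hBk, hc⟩ := hk.exists_monomial_zero_mul_eq hP hp hd
  have hπ : Prime ((qShift q ^ k) p) := prime_qShift_pow hp k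
  have hBk' : ∀ m, n < m → ¬ ((qShift q ^ k) p) ^ m ∣ B.coeff k := by
    intro m hm hdvd
    have h1 := (pow_dvd_pow _ (show n + 1 ≤ m by omega)).trans hdvd
    rw [hBk, pow_succ, mul_dvd_mul_iff_left (pow_ne_zero _ hπ.ne_zero)] at h1
    exact hc h1
  by_cases hpX : p ∣ X
  · have hpX : Associated p X := hp.associated_of_dvd prime_X hpX
    have hass : ∀ i, Associated ((qShift q ^ i) p) p := by
      intro i
      have h1 : Associated ((qShift q ^ i) p) ((qShift q ^ i) X) := hpX.map (qShift q ^ i)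
      have h2 : Associated ((qShift q ^ i) X) (X : F[X]) := by
        rw [qShift_pow_apply, X_comp]
        exact associated_unit_mul_left _ _ (isUnit_C.2 (pow_ne_zero i q.ne_zero).isUnit)
      exact (h1.trans h2).trans hpX.symm
    have hdvd : ∀ m, p ^ d ∣ P.coeff m := by
      -- Gauss' lemma with `a = n` and `b = d - 1`: `p^(n+d)` divides `B P`, but `p^(n+1)` does not
      -- divide `B.coeff k`, so `p^d` divides every coefficient of `P`.
      obtain ⟨b, rfl⟩ : ∃ b, d = b + 1 := ⟨d - 1, by omega⟩
      refine (SkewOp.pow_dvd_coeff_of_pow_dvd_coeff_mul (a := n) (b := b) hp ?_ (A := B) (B := P)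
        fun m => ?_).resolve_left fun hA => ?_
      · intro i m a
        rw [qShift_toRingEquiv_pow_apply, ← ((hass i).pow_pow (n := m)).dvd_iff_dvd_left,
          ← map_pow, map_dvd_iff]
      · rw [← hTB, SkewOp.coeff_monomial_zero_mul]
        exact (((hass k).pow_pow (n := n + b + 1)).dvd_iff_dvd_left.1 hs).mul_right _
      · exact hBk' (n + 1) (by omega) (((hass k).pow_pow (n := n + 1)).dvd_iff_dvd_left.2 (hA k))
    obtain ⟨T', hT'⟩ := SkewOp.exists_eq_monomial_zero_mul hdvd
    have hpd : p ^ d ≠ 0 := pow_ne_zero _ hp.ne_zero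
    have hcoeff : ∀ m, P.coeff m = p ^ d * T'.coeff m := by
      intro m
      conv_lhs => rw [hT']
      rw [SkewOp.coeff_monomial_zero_mul]
    refine ⟨T'.coeff P.order, P.shiftedLeadIdeal_mono (Nat.zero_le _) ⟨T',
      mem_cont_of_monomial_zero_mul_eq hpd (by rw [← hT', one_mul]), fun m hm => ?_, rfl⟩, 1,
      fun h1 => hp.not_isUnit (isUnit_of_dvd_one h1), ?_⟩
    · have := hcoeff m
      rw [SkewOp.coeff_eq_zero_of_order_lt hm] at this
      exact (mul_eq_zero.1 this.symm).resolve_left hpd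
    · rw [one_mul, ← hcoeff]
      rfl
  · have hpf : p ∣ f := by
      rw [hf] at hpdvd
      exact (hp.dvd_or_dvd hpdvd).resolve_left fun h1 => hpX (hp.dvd_of_dvd_pow h1)
    obtain ⟨j, hjk, hj, t, B', T', ht, hT', hT'0, htop⟩ := SkewOp.exists_order_reduction hπ hs hTB hB0
      (hBk' (n + d) (by omega)) (fun m hm => SkewOp.coeff_eq_zero_of_order_lt (P := P) hm)
    obtain ⟨i, rfl⟩ := Nat.exists_eq_add_of_le hjk
    rw [Nat.add_sub_cancel_left] at *
    have hsplit : ∀ a, (qShift q ^ (j + i)) a = (qShift q ^ j) ((qShift q ^ i) a) := by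
      intro a
      rw [pow_add, AlgEquiv.mul_apply]
    -- With `k = j + i`, cancelling `σ^j` in `hj` leaves `σ^i p ∣ ℓ₀`; moreover `σ^i p ∣ σ^i f`.
    have hle : i ≤ qDispersion q f (P.coeff 0) := by
      refine le_qDispersion hq hf0 h0 (prime_qShift_pow hp i).irreducible
        ((map_dvd_iff (qShift q ^ i)).2 hpf) ?_
      rw [hsplit, qShift_toRingEquiv_pow_apply, map_dvd_iff] at hj
      exact hj
    obtain ⟨g, hg⟩ := (qShift q ^ i).surjective (T'.coeff (i + P.order))
    obtain ⟨w, hw⟩ := (qShift q ^ (j + i)).surjective c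
    refine ⟨g, P.shiftedLeadIdeal_mono hle ⟨T', mem_cont_of_monomial_zero_mul_eq ht hT', ?_, ?_⟩,
      w, ?_, ?_⟩
    · intro m hm
      exact hT'0 m (by omega)
    · rw [hg, add_comm]
    · rwa [← hw, map_dvd_iff] at hc
    -- After applying `σ^k`, the claim is `htop` with the common factor `(σ^k p)^n` cancelled.
    · apply (qShift q ^ (j + i)).injective
      rw [map_mul, map_mul, map_pow, hw, hsplit g, hg]
      apply mul_left_cancel₀ (pow_ne_zero n hπ.ne_zero)
      rw [qShift_toRingEquiv_pow_apply, qShift_toRingEquiv_pow_apply, hBk] at htop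
      rw [← mul_assoc, ← pow_add, htop, mul_assoc]
      rfl

end QWeyl

/-! ### Factorization of the leading coefficient and the main theorem -/

/-- The prime factorizations of a nonzero polynomial and of a divisor over the same primes. -/
theorem Polynomial.exists_prod_pow_of_dvd {f h : F[X]} (hf : f ≠ 0) (hh : h ∣ f) :
    ∃ (m : ℕ) (p : Fin m → F[X]) (e k : Fin m → ℕ), (∀ i, Irreducible (p i)) ∧
      (∀ i j, i ≠ j → IsCoprime (p i) (p j)) ∧ (∀ i, 0 < e i) ∧
      Associated f (∏ i, p i ^ e i) ∧ Associated h (∏ i, p i ^ k i) := by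
  classical
  have hh0 : h ≠ 0 := ne_zero_of_dvd_ne_zero hf hh
  let N := UniqueFactorizationMonoid.normalizedFactors f
  let ε := N.toFinset.equivFin
  have hmem : ∀ i, (ε.symm i : F[X]) ∈ N := fun i => Multiset.mem_toFinset.1 (ε.symm i).2
  have hprod : ∀ M : Multiset F[X], M ⊆ N → ∏ i, (ε.symm i : F[X]) ^ M.count (ε.symm i : F[X]) =
      M.prod := by
    intro M hM
    rw [Finset.prod_multiset_count_of_subset M N.toFinset (Multiset.toFinset_subset.2 hM),
      ← Finset.prod_coe_sort N.toFinset fun a => a ^ M.count a,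
      ← ε.symm.prod_comp]
  -- The primes are the distinct normalized factors of `f`; an exponent for `h` may be zero.
  refine ⟨_, fun i => ε.symm i, fun i => N.count (ε.symm i : F[X]),
    fun i => (UniqueFactorizationMonoid.normalizedFactors h).count (ε.symm i : F[X]),
    fun i => UniqueFactorizationMonoid.irreducible_of_normalized_factor _ (hmem i), ?_,
    fun i => Multiset.count_pos.2 (hmem i), ?_, ?_⟩
  · intro i j hij
    have hirr := UniqueFactorizationMonoid.irreducible_of_normalized_factor _ (hmem i)
    refine (hirr.coprime_iff_not_dvd).2 fun hdvd => hij ?_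
    have hirr' := UniqueFactorizationMonoid.irreducible_of_normalized_factor _ (hmem j)
    have := normalize_eq_normalize_iff_associated.2 (hirr.associated_of_dvd hirr' hdvd)
    rw [UniqueFactorizationMonoid.normalize_normalized_factor _ (hmem i),
      UniqueFactorizationMonoid.normalize_normalized_factor _ (hmem j)] at this
    exact ε.symm.injective (Subtype.ext this)
  · rw [hprod N (Multiset.Subset.refl _)]
    exact (UniqueFactorizationMonoid.prod_normalizedFactors hf).symm
  · rw [hprod _ (Multiset.subset_of_le
      ((UniqueFactorizationMonoid.dvd_iff_normalizedFactors_le_normalizedFactors hh0 hf).1 hh))]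
    exact (UniqueFactorizationMonoid.prod_normalizedFactors hh0).symm

end QWeyl

end

theorem theorem1 {K F : Type*} [Field K] [CharZero K] [Field F] [Algebra K F]
    (q : Fˣ) (hq : Transcendental K (q : F))
    (hF : IntermediateField.adjoin K {(q : F)} = ⊤)
    (P : QWeyl q) (hr : 0 < P.order) (h0 : P.coeff 0 ≠ 0)
    (e : ℕ) (f : Polynomial F) (hf : P.lc = Polynomial.X ^ e * f) (hf0 : f.eval 0 ≠ 0) :
    ∃ L : QWeyl q, P.IsDesingularized L ∧
      L.order = P.order + qDispersion q f (P.coeff 0) := by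
  have hq1 : ∀ n : ℕ, 0 < n → (q : F) ^ n ≠ 1 := by
    intro n hn h1
    exact hq (IsAlgebraic.of_pow hn (by rw [h1]; exact isAlgebraic_one))
  have hP : P.lc ≠ 0 := SkewOp.lc_ne_zero (by
    rintro rfl
    exact h0 rfl)
  set D := qDispersion q f (P.coeff 0) with hD
  obtain ⟨g, hg⟩ := IsPrincipalIdealRing.principal (P.shiftedLeadIdeal D)
  have hgdvd : ∀ a ∈ P.shiftedLeadIdeal D, g ∣ a := by
    intro a ha
    rw [hg] at ha
    exact Ideal.mem_span_singleton.1 ha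
  obtain ⟨h, hh⟩ := hgdvd _ (P.lc_mem_shiftedLeadIdeal D)
  have hg0 : g ≠ 0 := left_ne_zero_of_mul (hh ▸ hP)
  have hh0 : h ≠ 0 := right_ne_zero_of_mul (hh ▸ hP)
  obtain ⟨L, hL, hL0, hLg⟩ : g ∈ P.shiftedLeadIdeal D := by
    rw [hg]
    exact Ideal.mem_span_singleton_self g
  have hLne : L.coeff (P.order + D) ≠ 0 := by
    rw [hLg]
    exact (map_ne_zero_iff _ (qShift q ^ D).injective).2 hg0
  have hord : L.order = P.order + D := SkewOp.order_eq hLne hL0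
  have hlc : L.lc = (qShift q ^ D) g := by rw [SkewOp.lc, hord, hLg]
  obtain ⟨m, p, e, k, hirr, hcop, he, hPe, hhk⟩ :=
    exists_prod_pow_of_dvd hP (hh ▸ dvd_mul_left h g : h ∣ P.lc)
  -- The unit relating `∏ pᵢ^kᵢ` to `h` is a nonzero constant, which becomes the denominator `b`;
  -- the numerator is `a = 1`.
  obtain ⟨u, hu⟩ := hhk.symm
  obtain ⟨b, hb, hbu⟩ := isUnit_iff.1 u.isUnit
  refine ⟨L, ⟨?_, hL, m, p, e, k, 1, b, hirr, hcop, he, hPe, hb.ne_zero, ?_, ?_⟩, hord⟩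
  · rintro rfl
    exact hLne rfl
  · have hL' : (qShift q ^ ((P.order : ℤ) - (L.order : ℤ))) L.lc = g := by
      rw [hord, show (P.order : ℤ) - ((P.order + D : ℕ) : ℤ) = -(D : ℤ) by push_cast; ring,
        qShift_zpow_neg_apply_eq_iff, hlc]
    have hden : algebraMap F[X] (RatFunc F) (C b) *
        ∏ i, algebraMap F[X] (RatFunc F) (p i) ^ k i = algebraMap F[X] (RatFunc F) h := by
      rw [← hu, map_mul, hbu, mul_comm, map_prod]
      simp only [map_pow]
    have hh' : algebraMap F[X] (RatFunc F) h ≠ 0 := RatFunc.algebraMap_ne_zero hh0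
    rw [hL', hden, hh, map_mul, map_one, map_one]
    field_simp
  · intro i d hd hrem
    have hp : Prime (p i) := (hirr i).prime
    -- Since `g ∣ a`, cancelling `g` gives `pᵢ^d ∣ w h`, hence `pᵢ^d ∣ h`. The other primes are
    -- coprime to `pᵢ`, so `d ≤ kᵢ`, a contradiction.
    obtain ⟨a, ha, w, hw, hwa⟩ := hrem.exists_mem_shiftedLeadIdeal hq1 h0 hf hf0 hp (by omega)
    obtain ⟨y, rfl⟩ := hgdvd a ha
    have h1 : p i ^ d * y = w * h := by
      apply mul_left_cancel₀ hg0
      rw [hh] at hwa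
      linear_combination hwa
    have h2 : p i ^ d ∣ ∏ j, p j ^ k j := by
      rw [← hhk.dvd_iff_dvd_right]
      exact hp.pow_dvd_of_dvd_mul_left d hw ⟨y, h1.symm⟩
    rw [← Finset.mul_prod_erase _ _ (Finset.mem_univ i)] at h2
    have h3 : IsCoprime (p i ^ d) (∏ j ∈ Finset.univ.erase i, p j ^ k j) :=
      IsCoprime.prod_right fun j hj => (hcop i j (Finset.ne_of_mem_erase hj).symm).pow
    have h4 := (pow_dvd_pow_iff hp.ne_zero hp.not_isUnit).1 (h3.dvd_of_dvd_mul_right h2)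
    omega
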